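/- Let $Q$ be a finite field. A linear systematic $(n,k,r,t)$ PIR code over $Q$ is an injective linear map $\mathcal C\colon Q^k\to Q^n$, $x\mapsto y$, such that $x$ is a sub-vector of $y$ and such that for every $i\in\{1,\dots,k\}$ there are $t$ pairwise disjoint sets $R_1,\dots,R_t\subseteq\{1,\dots,n\}$ with $|R_\ell|\le r$, for each of which $x_i$ is a function of the symbols $(y_j)_{j\in R_\ell}$. Let $\mathcal P_Q(k,r,t)$ be the smallest $n$ for which such a code over $Q$ exists, and let $\mathcal P(k,r,t)$ be the smallest $n$ for which such a code over some finite field exists. Let $k\ge 1$ and $3\le t\le \max\{\lceil k/2\rceil,2\}+2$. Then $$k+t-2+\left\lceil\frac{(t-1)(k-1)+1}{t}\right\rceil\le \mathcal P(k,2,t),$$ and, if $k\ge 3$, $$\mathcal P(k,2,t)\le k+\left\lceil (t-1)\cdot\frac k2\right\rceil .$$ The same bounds hold for $\mathcal P_Q(k,2,t)$, for every finite field $Q$. Moreover, if $t\le k$ (which, for $k\ge3$, excludes only $k=3$, $t=4$), then there is a binary $k\times\lceil (t-1)k/2\rceil$ matrix $A$ with all columns of weight at most $2$, all rows of weight $t-1$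 and no 1-squares (that is, for all rows $i_1\ne i_2$ and columns $j_1\ne j_2$ at least one of the entries $A_{i_1,j_1},A_{i_1,j_2},A_{i_2,j_1},A_{i_2,j_2}$ is zero), such that $[\,I_k\mid A\,]$ generates a binary PIR code with recovery sets of size at most $2$ and query size $t$. -/

import Mathlib

/-- The information symbol `x i` is a function of the coded symbols `C x j`, `j ∈ R`, that is,
`R` is a recovery set for the `i`-th information symbol. -/
def IsRecoverySet {Q ι : Type*} {k : ℕ} (C : (Fin k → Q) → (ι → Q)) (R : Finset ι)
    (i : Fin k) : Prop :=
  ∃ D : (R → Q) → Q, ∀ x : Fin k → Q, D (fun j => C x j) = x i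

/-- The query `(x (q 0), …, x (q (t - 1)))` can be reconstructed from `t` respective pairwise
disjoint recovery sets of size at most `r`. -/
def SupportsQuery {Q ι : Type*} {k t : ℕ} (C : (Fin k → Q) → (ι → Q)) (r : ℕ)
    (q : Fin t → Fin k) : Prop :=
  ∃ R : Fin t → Finset ι,
    (∀ l, (R l).card ≤ r) ∧
    (∀ l l', l ≠ l' → Disjoint (R l) (R l')) ∧
    (∀ l, IsRecoverySet C (R l) (q l))

/-- `C` is a PIR code with recovery sets of size at most `r` and query size `t`:
it is an injective encoding that supports all constant queries `(x i, …, x i)` of size `t`.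
The length of the code is the number of elements of `ι`. -/
def IsPIRCode {Q ι : Type*} {k : ℕ} (C : (Fin k → Q) → (ι → Q)) (r t : ℕ) : Prop :=
  Function.Injective C ∧ ∀ i : Fin k, SupportsQuery C r (fun _ : Fin t => i)

/-- The encoding is systematic: the information vector is a sub-vector of the codeword. -/
def IsSystematic {Q ι : Type*} {k : ℕ} (C : (Fin k → Q) → (ι → Q)) : Prop :=
  ∃ e : Fin k ↪ ι, ∀ (x : Fin k → Q) (i : Fin k), C x (e i) = x i

/-- There is a linear systematic `(n, k, r, t)` PIR code over the field `F`. -/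
def ExistsSystematicPIR (F : Type*) [Field F] (n k r t : ℕ) : Prop :=
  ∃ C : (Fin k → F) →ₗ[F] (Fin n → F), IsSystematic (C : (Fin k → F) → (Fin n → F)) ∧
    IsPIRCode (C : (Fin k → F) → (Fin n → F)) r t

/-- The optimal (shortest) length of a linear systematic PIR code over the fixed field `F`. -/
noncomputable def optimalPIRLengthOver (F : Type*) [Field F] (k r t : ℕ) : ℕ :=
  sInf {n : ℕ | ExistsSystematicPIR F n k r t}

/-- The optimal (shortest) length `P(k, r, t)` of a linear systematic PIR code, over all
finite fields. -/
noncomputable def optimalPIRLength (k r t : ℕ) : ℕ :=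
  sInf {n : ℕ | ∃ (F : Type) (_ : Field F) (_ : Finite F), ExistsSystematicPIR F n k r t}

/-- A matrix has no 1-square: no two distinct rows and two distinct columns meet in four
non-zero entries. -/
def HasNoOneSquare {F : Type*} [Zero F] {k m : ℕ} (A : Matrix (Fin k) (Fin m) F) : Prop :=
  ∀ i₁ i₂ : Fin k, ∀ j₁ j₂ : Fin m, i₁ ≠ i₂ → j₁ ≠ j₂ →
    A i₁ j₁ = 0 ∨ A i₁ j₂ = 0 ∨ A i₂ j₁ = 0 ∨ A i₂ j₂ = 0

/-- The linear encoding `x ↦ x ⬝ [I | A]`. -/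
def systematicEncoding {F : Type*} [Field F] {k m : ℕ} (A : Matrix (Fin k) (Fin m) F) :
    (Fin k → F) → (Fin k ⊕ Fin m → F) :=
  fun x => Matrix.vecMul x (Matrix.fromCols (1 : Matrix (Fin k) (Fin k) F) A)

/-!
View the coded symbols as linear functionals of the information vector. A set of coordinates that
does not determine some symbol `x i` misses at least one coordinate from each of the `t` recovery
sets of that symbol, so it has at most `n - t` elements. For the lower bound we therefore look for
a large set of corank one. Start from the empty set and repeatedly add a systematic coordinate that
is not yet spanned, followed by recovery sets of it: as that coordinate is then available, each
recovery set of size two raises the rank by at most one and creates one more linear relation. The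
rank grows by at most one at each step, so the process passes through corank one, and by then the
number of relations is about `(t - 1) / t` times the rank.

For the upper bound the redundant columns are the edges of a graph on `k` vertices in which every
vertex has degree `t - 1` (with a singleton to fix the parity), obtained from an arbitrary graph
with the right number of edges by moving edge ends from vertices of large degree to vertices of
small degree. The edges at `i` and `i` itself provide `t` disjoint recovery sets. In the remaining
case `k = 3`, `t = 4` the Hadamard code of length eight has the required length.
-/

open scoped Finset
open Submodule (span)

/-! ### Recovery sets -/

section Recovery

variable {Q ι κ : Type*} {k r t : ℕ} {C : (Fin k → Q) → (ι → Q)} {i : Fin k}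

theorem IsRecoverySet.mono {R T : Finset ι} (hR : IsRecoverySet C R i) (hRT : R ⊆ T) :
    IsRecoverySet C T i := by
  obtain ⟨D, hD⟩ := hR
  exact ⟨fun y => D fun j => y ⟨j, hRT j.2⟩, hD⟩

theorem IsRecoverySet.reindex {R : Finset ι} (hR : IsRecoverySet C R i) (σ : ι ≃ κ) :
    IsRecoverySet (fun x => C x ∘ σ.symm) (R.map σ.toEmbedding) i := by
  obtain ⟨D, hD⟩ := hR
  exact ⟨fun y => D fun j => y ⟨σ j, by simp⟩, fun x => by simpa using hD x⟩

theorem SupportsQuery.reindex {q : Fin t → Fin k} (hq : SupportsQuery C r q) (σ : ι ≃ κ) :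
    SupportsQuery (fun x => C x ∘ σ.symm) r q := by
  obtain ⟨R, hcard, hdisj, hrec⟩ := hq
  exact ⟨fun l => (R l).map σ.toEmbedding, fun l => by simpa using hcard l,
    fun l l' hl => (Finset.disjoint_map _).2 (hdisj l l' hl), fun l => (hrec l).reindex σ⟩

theorem supportsQuery_const_of_pairwise_disjoint [Fintype κ] (ht : t ≤ Fintype.card κ)
    {R : κ → Finset ι} (hcard : ∀ l, #(R l) ≤ r) (hdisj : Pairwise (Function.onFun Disjoint R))
    (hrec : ∀ l, IsRecoverySet C (R l) i) : SupportsQuery C r (fun _ : Fin t => i) := by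
  obtain ⟨f⟩ : Nonempty (Fin t ↪ κ) := Function.Embedding.nonempty_of_card_le (by simpa using ht)
  exact ⟨fun l => R (f l), fun l => hcard _, fun l l' hl => hdisj (f.injective.ne hl),
    fun l => hrec _⟩

theorem SupportsQuery.card_add_le_of_not_isRecoverySet [Fintype ι]
    (hq : SupportsQuery C r (fun _ : Fin t => i)) {T : Finset ι} (hT : ¬IsRecoverySet C T i) :
    #T + t ≤ Fintype.card ι := by
  classical
  obtain ⟨R, -, hdisj, hrec⟩ := hq
  have hout : ∀ l, ∃ j ∈ R l, j ∉ T := fun l =>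
    Finset.not_subset.1 fun hRT => hT ((hrec l).mono hRT)
  choose f hfR hfT using hout
  have hinj : Function.Injective f := fun l l' hll' => by
    by_contra hne
    exact Finset.disjoint_left.1 (hdisj l l' hne) (hfR l) (hll' ▸ hfR l')
  have hle : t ≤ #Tᶜ := by
    simpa using Finset.card_le_card_of_injOn (s := Finset.univ) f (by simpa using hfT) hinj.injOn
  have hcompl := Finset.card_add_card_compl T
  omega

theorem IsSystematic.injective (hC : IsSystematic C) : Function.Injective C := by
  obtain ⟨e, he⟩ := hC
  intro x y hxy
  funext i
  rw [← he x i, ← he y i, hxy]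

end Recovery

section LinearCode

variable {F ι : Type*} [Field F] {k r t : ℕ}

theorem isRecoverySet_iff_forall_eq_zero (C : (Fin k → F) →ₗ[F] (ι → F)) (R : Finset ι)
    (i : Fin k) : IsRecoverySet C R i ↔ ∀ x, (∀ j ∈ R, C x j = 0) → x i = 0 := by
  constructor
  · rintro ⟨D, hD⟩ x hx
    have hrestrict : (fun j : R => C x j) = fun j : R => C 0 j := by
      funext j
      simp [hx j j.2]
    rw [← hD x, hrestrict, hD 0, Pi.zero_apply]
  · intro h
    have hfactors : Function.FactorsThrough (fun x : Fin k → F => x i)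
        (fun x => fun j : R => C x j) := by
      intro x y hxy
      refine sub_eq_zero.1 (h (x - y) fun j hj => ?_)
      simpa [sub_eq_zero] using congrFun hxy ⟨j, hj⟩
    exact ⟨Function.extend (fun x => fun j : R => C x j) (fun x => x i) 0,
      fun x => hfactors.extend_apply 0 x⟩

/-- The `j`-th coded symbol as a linear functional of the information vector, that is, the `j`-th
column of a generator matrix. -/
def codeFunctional (C : (Fin k → F) →ₗ[F] (ι → F)) (j : ι) : Module.Dual F (Fin k → F) :=
  LinearMap.proj j ∘ₗ C

theorem IsRecoverySet.proj_mem_span {C : (Fin k → F) →ₗ[F] (ι → F)} {R : Finset ι} {i : Fin k}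
    (hR : IsRecoverySet C R i) :
    LinearMap.proj i ∈ span F (codeFunctional C '' (R : Set ι)) := by
  rw [isRecoverySet_iff_forall_eq_zero] at hR
  rw [Set.image_eq_range]
  refine mem_span_of_iInf_ker_le_ker fun x hx => ?_
  simp only [Submodule.mem_iInf] at hx
  exact hR x fun j hj => hx ⟨j, hj⟩

theorem existsSystematicPIR_of_card_eq [Fintype ι] {n : ℕ} (hn : Fintype.card ι = n)
    (C : (Fin k → F) →ₗ[F] (ι → F)) (hsys : IsSystematic C)
    (hq : ∀ i, SupportsQuery C r (fun _ : Fin t => i)) : ExistsSystematicPIR F n k r t := by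
  let σ : ι ≃ Fin n := Fintype.equivFinOfCardEq hn
  let C' : (Fin k → F) →ₗ[F] (Fin n → F) := LinearMap.funLeft F F σ.symm ∘ₗ C
  have hsys' : IsSystematic C' := by
    obtain ⟨e, he⟩ := hsys
    exact ⟨e.trans σ.toEmbedding, fun x i => by simp [C', LinearMap.funLeft, he]⟩
  exact ⟨C', hsys', hsys'.injective, fun i => (hq i).reindex σ⟩

theorem existsSystematicPIR_repetition (F : Type*) [Field F] (k : ℕ) (hr : 1 ≤ r) (ht : 1 ≤ t) :
    ExistsSystematicPIR F (k * t) k r t := by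
  let C : (Fin k → F) →ₗ[F] (Fin k × Fin t → F) := LinearMap.funLeft F F Prod.fst
  refine existsSystematicPIR_of_card_eq (by simp) C ?_ fun i => ?_
  · exact ⟨⟨fun i => (i, ⟨0, ht⟩), fun i j h => congrArg Prod.fst h⟩, fun x i => rfl⟩
  · refine ⟨fun l => {(i, l)}, fun l => by simpa using hr, by simp, fun l => ?_⟩
    rw [isRecoverySet_iff_forall_eq_zero]
    exact fun x hx => hx (i, l) (Finset.mem_singleton_self _)

end LinearCode

/-! ### Rank and nullity of a subfamily of vectors -/

section Rank

variable (K : Type*) {V ι : Type*} [DivisionRing K] [AddCommGroup V] [Module K V] (φ : ι → V)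

/-- The rank of the vectors `φ j`, `j ∈ S`. -/
noncomputable def subfamilyRank (S : Finset ι) : ℕ := (φ '' (S : Set ι)).finrank K

/-- The nullity of the vectors `φ j`, `j ∈ S`: the number of independent linear relations between
them. The subtraction does not truncate, see `subfamilyRank_add_subfamilyNullity`. -/
noncomputable def subfamilyNullity (S : Finset ι) : ℕ := #S - subfamilyRank K φ S

theorem subfamilyRank_le_card (S : Finset ι) : subfamilyRank K φ S ≤ #S := by
  classical
  rw [subfamilyRank, ← Finset.coe_image]
  exact (finrank_span_finset_le_card _).trans Finset.card_image_le

theorem subfamilyRank_add_subfamilyNullity (S : Finset ι) :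
    subfamilyRank K φ S + subfamilyNullity K φ S = #S :=
  Nat.add_sub_cancel' (subfamilyRank_le_card K φ S)

variable {K φ} in
theorem exists_notMem_span_of_subfamilyRank_lt {I : Set ι} (hI : span K (φ '' I) = ⊤)
    {S : Finset ι} (hS : subfamilyRank K φ S < Module.finrank K V) :
    ∃ j ∈ I, φ j ∉ span K (φ '' (S : Set ι)) := by
  by_contra! hall
  have htop : span K (φ '' (S : Set ι)) = ⊤ := by
    rw [← top_le_iff, ← hI, Submodule.span_le]
    exact Set.image_subset_iff.2 hall
  rw [subfamilyRank, Set.finrank, htop, finrank_top] at hS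
  exact hS.false

variable [DecidableEq ι]

theorem subfamilyRank_union_le (S T : Finset ι) :
    subfamilyRank K φ (S ∪ T) ≤ subfamilyRank K φ S + #T := by
  have : FiniteDimensional K (span K (φ '' (S : Set ι))) :=
    FiniteDimensional.span_of_finite K (S.finite_toSet.image φ)
  have : FiniteDimensional K (span K (φ '' (T : Set ι))) :=
    FiniteDimensional.span_of_finite K (T.finite_toSet.image φ)
  have hspan : span K (φ '' ((S ∪ T : Finset ι) : Set ι)) =
      span K (φ '' (S : Set ι)) ⊔ span K (φ '' (T : Set ι)) := by
    rw [Finset.coe_union, Set.image_union, Submodule.span_union]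
  calc subfamilyRank K φ (S ∪ T) ≤ subfamilyRank K φ S + subfamilyRank K φ T := by
        rw [subfamilyRank, Set.finrank, hspan]
        exact Submodule.finrank_add_le_finrank_add_finrank _ _
    _ ≤ subfamilyRank K φ S + #T := by
        gcongr
        exact subfamilyRank_le_card K φ T

theorem subfamilyNullity_le_union (S T : Finset ι) :
    subfamilyNullity K φ S ≤ subfamilyNullity K φ (S ∪ T) := by
  have hrank := subfamilyRank_union_le K φ S (T \ S)
  have hcard := Finset.card_union_of_disjoint (Finset.disjoint_sdiff (s := S) (t := T))
  rw [Finset.union_sdiff_self_eq_union] at hrank hcard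
  have hS := subfamilyRank_add_subfamilyNullity K φ S
  have hST := subfamilyRank_add_subfamilyNullity K φ (S ∪ T)
  omega

variable {K φ}

theorem subfamilyRank_insert_of_mem_span {S : Finset ι} {j : ι}
    (hj : φ j ∈ span K (φ '' (S : Set ι))) :
    subfamilyRank K φ (insert j S) = subfamilyRank K φ S := by
  rw [subfamilyRank, subfamilyRank, Set.finrank, Set.finrank, Finset.coe_insert,
    Set.image_insert_eq, Submodule.span_insert_eq_span hj]

theorem subfamilyNullity_insert_of_mem_span {S : Finset ι} {j : ι} (hjS : j ∉ S)
    (hj : φ j ∈ span K (φ '' (S : Set ι))) :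
    subfamilyNullity K φ (insert j S) = subfamilyNullity K φ S + 1 := by
  have hcard := Finset.card_insert_of_notMem hjS
  have hinsert := subfamilyRank_add_subfamilyNullity K φ (insert j S)
  have hS := subfamilyRank_add_subfamilyNullity K φ S
  rw [subfamilyRank_insert_of_mem_span hj] at hinsert
  omega

theorem exists_mem_span_insert_union_erase {S R : Finset ι} {w : V}
    (hwS : w ∉ span K (φ '' (S : Set ι)))
    (hw : w ∈ span K (φ '' ((S ∪ R : Finset ι) : Set ι))) :
    ∃ j ∈ R, j ∉ S ∧
      φ j ∈ span K (insert w (φ '' ((S ∪ R.erase j : Finset ι) : Set ι))) := by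
  induction R using Finset.induction_on with
  | empty => exact absurd (by simpa using hw) hwS
  | insert a R haR ih =>
    by_cases hwR : w ∈ span K (φ '' ((S ∪ R : Finset ι) : Set ι))
    · obtain ⟨j, hjR, hjS, hj⟩ := ih hwR
      refine ⟨j, Finset.mem_insert_of_mem hjR, hjS, Submodule.span_mono ?_ hj⟩
      gcongr
      exact Finset.subset_insert _ _
    · have haS : a ∉ S := fun haS => hwR (by rwa [Finset.union_insert,
        Finset.insert_eq_of_mem (Finset.mem_union_left R haS)] at hw)
      rw [Finset.union_insert, Finset.coe_insert, Set.image_insert_eq] at hw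
      refine ⟨a, Finset.mem_insert_self a R, haS, ?_⟩
      rw [Finset.erase_insert haR]
      exact mem_span_insert_exchange hw hwR

end Rank

/-! ### Repair groups -/

section Repair

/-- The sets `R l` are pairwise disjoint repair groups of size at most `r` for the coordinate `j`:
each of them avoids `j` and has `φ j` in the span of its vectors. -/
structure IsRepairFamily (K : Type*) {V ι κ : Type*} [DivisionRing K] [AddCommGroup V]
    [Module K V] (φ : ι → V) (r : ℕ) (j : ι) (R : κ → Finset ι) : Prop where
  card_le : ∀ l, #(R l) ≤ r
  notMem : ∀ l, j ∉ R l
  pairwise_disjoint : Pairwise (Function.onFun Disjoint R)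
  mem_span : ∀ l, φ j ∈ span K (φ '' (R l : Set ι))

variable {K V ι κ : Type*} [DivisionRing K] [AddCommGroup V] [Module K V] [DecidableEq ι]
  {φ : ι → V} {r : ℕ} {j : ι} {R : κ → Finset ι} {S : Finset ι} {L : Finset κ} {l : κ}

theorem IsRepairFamily.inter_subset (hR : IsRepairFamily K φ r j R) (hl : l ∉ L) :
    R l ∩ (insert j S ∪ L.biUnion R) ⊆ S := by
  intro a ha
  simp only [Finset.mem_inter, Finset.mem_union, Finset.mem_insert, Finset.mem_biUnion] at ha
  obtain ⟨haR, (rfl | haS) | ⟨l', hl', haR'⟩⟩ := ha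
  · exact absurd haR (hR.notMem l)
  · exact haS
  · have hne : l ≠ l' := fun h => hl (h ▸ hl')
    exact absurd haR' (Finset.disjoint_left.1 (hR.pairwise_disjoint hne) haR)

/-- Since `φ j` is not spanned by `S`, its expansion in terms of the new repair group involves a
coordinate outside `S`; as `j` itself is already available, that coordinate comes for free. -/
theorem IsRepairFamily.exists_mem_span_union_erase (hR : IsRepairFamily K φ r j R)
    (hj : φ j ∉ span K (φ '' (S : Set ι))) (hl : l ∉ L) :
    ∃ a ∈ R l, a ∉ insert j S ∪ L.biUnion R ∧
      φ a ∈ span K (φ '' ((insert j S ∪ L.biUnion R ∪ (R l).erase a : Finset ι) : Set ι)) := by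
  have hjSR : φ j ∈ span K (φ '' ((S ∪ R l : Finset ι) : Set ι)) :=
    Submodule.span_mono (Set.image_mono (by simp)) (hR.mem_span l)
  obtain ⟨a, haR, haS, ha⟩ := exists_mem_span_insert_union_erase hj hjSR
  refine ⟨a, haR, fun h => haS (hR.inter_subset hl (Finset.mem_inter.2 ⟨haR, h⟩)),
    Submodule.span_mono ?_ ha⟩
  rw [← Set.image_insert_eq, ← Finset.coe_insert]
  gcongr
  rw [← Finset.insert_union]
  gcongr
  exact Finset.subset_union_left

theorem IsRepairFamily.subfamilyRank_union_add_one_le (hR : IsRepairFamily K φ r j R)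
    (hj : φ j ∉ span K (φ '' (S : Set ι))) (hl : l ∉ L) :
    subfamilyRank K φ (insert j S ∪ L.biUnion R ∪ R l) + 1 ≤
      subfamilyRank K φ (insert j S ∪ L.biUnion R) + r := by
  obtain ⟨a, haR, -, ha⟩ := hR.exists_mem_span_union_erase hj hl
  rw [← Finset.insert_erase haR, Finset.union_insert, subfamilyRank_insert_of_mem_span ha]
  have hunion := subfamilyRank_union_le K φ (insert j S ∪ L.biUnion R) ((R l).erase a)
  have herase := Finset.card_erase_add_one haR
  have hcard := hR.card_le l
  omega

theorem IsRepairFamily.subfamilyNullity_add_one_le_union (hR : IsRepairFamily K φ r j R)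
    (hj : φ j ∉ span K (φ '' (S : Set ι))) (hl : l ∉ L) :
    subfamilyNullity K φ (insert j S ∪ L.biUnion R) + 1 ≤
      subfamilyNullity K φ (insert j S ∪ L.biUnion R ∪ R l) := by
  obtain ⟨a, haR, haU, ha⟩ := hR.exists_mem_span_union_erase hj hl
  have ha' : a ∉ insert j S ∪ L.biUnion R ∪ (R l).erase a := by
    simpa only [Finset.mem_union, Finset.notMem_erase, or_false] using haU
  rw [← Finset.insert_erase haR, Finset.union_insert, subfamilyNullity_insert_of_mem_span ha' ha]
  gcongr
  exact subfamilyNullity_le_union K φ _ _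

theorem union_biUnion_insert [DecidableEq κ] (U : Finset ι) :
    U ∪ (insert l L).biUnion R = U ∪ L.biUnion R ∪ R l := by
  rw [Finset.biUnion_insert, Finset.union_comm (R l), Finset.union_assoc]

theorem IsRepairFamily.subfamilyRank_add_card_le (hR : IsRepairFamily K φ r j R)
    (hj : φ j ∉ span K (φ '' (S : Set ι))) (L : Finset κ) :
    subfamilyRank K φ (insert j S ∪ L.biUnion R) + #L ≤ subfamilyRank K φ S + 1 + #L * r := by
  classical
  induction L using Finset.induction_on with
  | empty =>
    rw [Finset.biUnion_empty, Finset.union_empty, Finset.insert_eq, Finset.union_comm]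
    simpa using subfamilyRank_union_le K φ S {j}
  | insert l L hl ih =>
    have hstep := hR.subfamilyRank_union_add_one_le hj hl
    rw [union_biUnion_insert, Finset.card_insert_of_notMem hl, add_mul]
    omega

theorem IsRepairFamily.subfamilyNullity_add_card_le (hR : IsRepairFamily K φ r j R)
    (hj : φ j ∉ span K (φ '' (S : Set ι))) (L : Finset κ) :
    subfamilyNullity K φ S + #L ≤ subfamilyNullity K φ (insert j S ∪ L.biUnion R) := by
  classical
  induction L using Finset.induction_on with
  | empty =>
    rw [Finset.biUnion_empty, Finset.union_empty, Finset.insert_eq, Finset.union_comm]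
    exact subfamilyNullity_le_union K φ S {j}
  | insert l L hl ih =>
    have hstep := hR.subfamilyNullity_add_one_le_union hj hl
    rw [union_biUnion_insert, Finset.card_insert_of_notMem hl]
    omega

theorem IsRepairFamily.exists_subfamilyRank_add_one_eq_or [Finite κ]
    (hR : IsRepairFamily K φ 2 j R) (hj : φ j ∉ span K (φ '' (S : Set ι)))
    (hlt : subfamilyRank K φ (insert j S) < Module.finrank K V) :
    ∃ L : Finset κ,
      subfamilyRank K φ (insert j S ∪ L.biUnion R) + 1 = Module.finrank K V ∨
      (∀ l, l ∈ L) ∧ subfamilyRank K φ (insert j S ∪ L.biUnion R) < Module.finrank K V := by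
  classical
  obtain ⟨L, hL⟩ := (Set.toFinite {L : Finset κ |
    subfamilyRank K φ (insert j S ∪ L.biUnion R) < Module.finrank K V}).exists_maximal
      ⟨∅, by simpa using hlt⟩
  refine ⟨L, or_iff_not_imp_right.2 fun hnot => ?_⟩
  obtain ⟨l, hl⟩ : ∃ l, l ∉ L := by
    by_contra! hall
    exact hnot ⟨hall, hL.prop⟩
  have hfull : Module.finrank K V ≤ subfamilyRank K φ (insert j S ∪ L.biUnion R ∪ R l) := by
    rw [← union_biUnion_insert]
    exact not_lt.1 (hL.not_prop_of_gt (Finset.ssubset_insert hl))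
  have hstep := hR.subfamilyRank_union_add_one_le hj hl
  have hlow := hL.prop
  simp only [Set.mem_ofPred_eq] at hlow
  omega

end Repair

theorem exists_subfamilyRank_add_one_eq_finrank {K V ι : Type*} [DivisionRing K] [AddCommGroup V]
    [Module K V] [Finite ι] {φ : ι → V} {s : ℕ} {I : Set ι}
    (hI : span K (φ '' I) = ⊤) (hV : 0 < Module.finrank K V)
    (hrepair : ∀ j ∈ I, ∃ R : Fin s → Finset ι, IsRepairFamily K φ 2 j R) :
    ∃ T : Finset ι, subfamilyRank K φ T + 1 = Module.finrank K V ∧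
      s * Module.finrank K V ≤ (s + 1) * subfamilyNullity K φ T + 2 * s := by
  classical
  -- The ratio of nullity to rank is kept at least `s / (s + 1)` for as long as possible.
  obtain ⟨S, hS⟩ := (Set.toFinite {S : Finset ι | subfamilyRank K φ S < Module.finrank K V ∧
    s * subfamilyRank K φ S ≤ (s + 1) * subfamilyNullity K φ S}).exists_maximal
      ⟨∅, by simpa [subfamilyRank] using hV⟩
  obtain ⟨hlt, hratio⟩ := hS.prop
  obtain ⟨j, hjI, hj⟩ := exists_notMem_span_of_subfamilyRank_lt hI hlt
  obtain ⟨R, hR⟩ := hrepair j hjI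
  have hrank := hR.subfamilyRank_add_card_le hj
  have hnullity := hR.subfamilyNullity_add_card_le hj
  by_cases hinsert : subfamilyRank K φ (insert j S) < Module.finrank K V
  · obtain ⟨L, hcorank | ⟨hall, hltL⟩⟩ := hR.exists_subfamilyRank_add_one_eq_or hj hinsert
    · refine ⟨_, hcorank, ?_⟩
      specialize hrank L
      specialize hnullity L
      nlinarith
    · obtain rfl : L = Finset.univ := Finset.eq_univ_of_forall hall
      have hgt : S ⊂ insert j S ∪ Finset.univ.biUnion R :=
        (Finset.ssubset_insert fun h => hj (Submodule.subset_span ⟨j, h, rfl⟩)).trans_subset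
          Finset.subset_union_left
      refine absurd ⟨hltL, ?_⟩ (hS.not_prop_of_gt hgt)
      specialize hrank Finset.univ
      specialize hnullity Finset.univ
      rw [Finset.card_univ, Fintype.card_fin] at hrank hnullity
      nlinarith
  · have hone := hrank ∅
    simp only [Finset.biUnion_empty, Finset.union_empty, Finset.card_empty] at hone
    exact ⟨S, by omega, by nlinarith⟩

/-! ### The lower bound -/

section LowerBound

variable {F ι : Type*} [Field F] {k r : ℕ} {C : (Fin k → F) →ₗ[F] (ι → F)} {e : Fin k ↪ ι}

theorem codeFunctional_systematic (he : ∀ x i, C x (e i) = x i) (i : Fin k) :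
    codeFunctional C (e i) = LinearMap.proj i :=
  LinearMap.ext fun x => he x i

theorem span_codeFunctional_systematic (he : ∀ x i, C x (e i) = x i) :
    span F (codeFunctional C '' Set.range e) = ⊤ := by
  have hbasis : ⇑(Pi.basisFun F (Fin k)).dualBasis = codeFunctional C ∘ e := by
    funext i
    ext x
    simp [codeFunctional_systematic he]
  rw [← Set.range_comp, ← hbasis, Module.Basis.span_eq]

/-- At most one of the recovery sets contains the systematic coordinate `e i`; dropping it leaves
repair groups for that coordinate. -/
theorem SupportsQuery.exists_isRepairFamily {s : ℕ} (he : ∀ x i, C x (e i) = x i) {i : Fin k}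
    (hq : SupportsQuery C r (fun _ : Fin (s + 1) => i)) :
    ∃ R : Fin s → Finset ι, IsRepairFamily F (codeFunctional C) r (e i) R := by
  obtain ⟨R, hcard, hdisj, hrec⟩ := hq
  obtain ⟨l₀, hl₀⟩ : ∃ l₀, ∀ l, l ≠ l₀ → e i ∉ R l := by
    by_contra! hall
    obtain ⟨l, -, hl⟩ := hall 0
    obtain ⟨l', hne, hl'⟩ := hall l
    exact Finset.disjoint_left.1 (hdisj l' l hne) hl' hl
  refine ⟨fun l => R (l₀.succAbove l), ⟨fun l => hcard _, fun l => hl₀ _ (Fin.succAbove_ne _ _),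
    fun l l' hl => hdisj _ _ (Fin.succAbove_right_injective.ne hl), fun l => ?_⟩⟩
  rw [codeFunctional_systematic he]
  exact (hrec _).proj_mem_span

theorem ExistsSystematicPIR.mul_length_ge {n s : ℕ} (hk : 1 ≤ k)
    (h : ExistsSystematicPIR F n k 2 (s + 1)) :
    s * k + (s + 1) * (k + s) ≤ (s + 1) * n + 2 * s := by
  obtain ⟨C, ⟨e, he⟩, -, hq⟩ := h
  have hdim : Module.finrank F (Module.Dual F (Fin k → F)) = k := by
    rw [Subspace.dual_finrank_eq, Module.finrank_fin_fun]
  have hspan := span_codeFunctional_systematic he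
  obtain ⟨T, hrank, hnullity⟩ := exists_subfamilyRank_add_one_eq_finrank (s := s) hspan
    (by omega) (by rintro - ⟨i, rfl⟩; exact (hq i).exists_isRepairFamily he)
  obtain ⟨-, ⟨i, rfl⟩, hi⟩ := exists_notMem_span_of_subfamilyRank_lt (S := T) hspan (by omega)
  have hnotrec : ¬IsRecoverySet C T i := fun hrec =>
    hi (codeFunctional_systematic he i ▸ hrec.proj_mem_span)
  have hcard := (hq i).card_add_le_of_not_isRecoverySet hnotrec
  have hsum := subfamilyRank_add_subfamilyNullity F (codeFunctional C) T
  rw [Fintype.card_fin] at hcard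
  have hn : k + subfamilyNullity F (codeFunctional C) T + s ≤ n := by omega
  rw [hdim] at hnullity
  nlinarith

theorem ExistsSystematicPIR.ceil_le_length {n t : ℕ} (hk : 1 ≤ k) (ht : 1 ≤ t)
    (h : ExistsSystematicPIR F n k 2 t) :
    (k : ℤ) + t - 2 + ⌈(((t : ℚ) - 1) * ((k : ℚ) - 1) + 1) / t⌉ ≤ n := by
  obtain ⟨s, rfl⟩ : ∃ s, t = s + 1 := Nat.exists_eq_add_of_le' ht
  have hlength : (s * k + (s + 1) * (k + s) : ℚ) ≤ (s + 1) * n + 2 * s := by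
    exact_mod_cast h.mul_length_ge hk
  rw [← le_sub_iff_add_le', Int.ceil_le, div_le_iff₀ (by positivity)]
  push_cast
  linarith

end LowerBound

/-! ### Codes from matrices without 1-squares -/

section MatrixCode

variable {F : Type*} [Field F] {k m r t : ℕ}

theorem systematicEncoding_inl (A : Matrix (Fin k) (Fin m) F) (x : Fin k → F) (i : Fin k) :
    systematicEncoding A x (Sum.inl i) = x i := by
  simp [systematicEncoding, Matrix.vecMul_fromCols]

theorem systematicEncoding_inr (A : Matrix (Fin k) (Fin m) F) (x : Fin k → F) (j : Fin m) :
    systematicEncoding A x (Sum.inr j) = ∑ i, x i * A i j := by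
  simp [systematicEncoding, Matrix.vecMul, dotProduct]

theorem isSystematic_systematicEncoding (A : Matrix (Fin k) (Fin m) F) :
    IsSystematic (systematicEncoding A) :=
  ⟨Function.Embedding.inl, systematicEncoding_inl A⟩

theorem IsPIRCode.existsSystematicPIR {A : Matrix (Fin k) (Fin m) F}
    (h : IsPIRCode (systematicEncoding A) r t) :
    ExistsSystematicPIR F (k + m) k r t :=
  existsSystematicPIR_of_card_eq (by simp) (Matrix.vecMulLinear (Matrix.fromCols 1 A))
    (isSystematic_systematicEncoding A) h.2

variable [DecidableEq F]

/-- The parity symbol `j` together with the information symbols other than `i` that it checks. -/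
def parityRecoverySet (A : Matrix (Fin k) (Fin m) F) (i : Fin k) (j : Fin m) :
    Finset (Fin k ⊕ Fin m) :=
  (({i' | A i' j ≠ 0} : Finset (Fin k)).erase i).disjSum {j}

variable {A : Matrix (Fin k) (Fin m) F} {i : Fin k} {j : Fin m}

theorem card_parityRecoverySet (hij : A i j ≠ 0) :
    #(parityRecoverySet A i j) = #{i' | A i' j ≠ 0} := by
  rw [parityRecoverySet, Finset.card_disjSum, Finset.card_singleton,
    Finset.card_erase_add_one (by simpa using hij)]

theorem isRecoverySet_parityRecoverySet (hij : A i j ≠ 0) :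
    IsRecoverySet (systematicEncoding A) (parityRecoverySet A i j) i := by
  refine (isRecoverySet_iff_forall_eq_zero
    (Matrix.vecMulLinear (Matrix.fromCols 1 A)) _ _).2 fun x hx => ?_
  replace hx : ∀ j' ∈ parityRecoverySet A i j, systematicEncoding A x j' = 0 := hx
  have hparity := hx (Sum.inr j) (by simp [parityRecoverySet])
  have hothers : ∀ i' ≠ i, x i' * A i' j = 0 := fun i' hi' => by
    by_contra hne
    have hmem : Sum.inl i' ∈ parityRecoverySet A i j := by
      simpa [parityRecoverySet, hi'] using right_ne_zero_of_mul hne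
    exact left_ne_zero_of_mul hne (systematicEncoding_inl A x i' ▸ hx _ hmem)
  rw [systematicEncoding_inr, Fintype.sum_eq_single i hothers] at hparity
  exact (mul_eq_zero.1 hparity).resolve_right hij

/-- An information symbol in two of the sets would give a 1-square together with `i`. -/
theorem HasNoOneSquare.disjoint_parityRecoverySet (hA : HasNoOneSquare A) {j' : Fin m}
    (hjj' : j ≠ j') (hj : A i j ≠ 0) (hj' : A i j' ≠ 0) :
    Disjoint (parityRecoverySet A i j) (parityRecoverySet A i j') := by
  rw [Finset.disjoint_left]
  rintro (i' | j'') h h'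
  · simp only [parityRecoverySet, Finset.inl_mem_disjSum, Finset.mem_erase,
      Finset.mem_filter_univ] at h h'
    have hsquare := hA i i' j j' (Ne.symm h.1) hjj'
    tauto
  · simp only [parityRecoverySet, Finset.inr_mem_disjSum, Finset.mem_singleton] at h h'
    exact hjj' (h.symm.trans h')

theorem HasNoOneSquare.supportsQuery (hA : HasNoOneSquare A) (hr : 1 ≤ r)
    (hcol : ∀ j, #{i | A i j ≠ 0} ≤ r) (hrow : t ≤ #{j | A i j ≠ 0} + 1) :
    SupportsQuery (systematicEncoding A) r (fun _ : Fin t => i) := by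
  let R : Option {j // A i j ≠ 0} → Finset (Fin k ⊕ Fin m)
    | none => {Sum.inl i}
    | some j => parityRecoverySet A i j
  have hself : ∀ j, Disjoint {Sum.inl i} (parityRecoverySet A i j) := fun j => by
    simp [parityRecoverySet]
  refine supportsQuery_const_of_pairwise_disjoint (R := R) ?_ ?_ ?_ ?_
  · rwa [Fintype.card_option, Fintype.card_subtype]
  · rintro (- | j)
    · exact hr
    · exact (card_parityRecoverySet j.2).trans_le (hcol j)
  · rintro (- | j) (- | j') hne
    · exact absurd rfl hne
    · exact hself j'
    · exact (hself j).symm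
    · exact hA.disjoint_parityRecoverySet (fun h => hne (congrArg some (Subtype.ext h))) j.2 j'.2
  · rintro (- | j)
    · exact ⟨fun y => y ⟨Sum.inl i, Finset.mem_singleton_self _⟩,
        fun x => systematicEncoding_inl A x i⟩
    · exact isRecoverySet_parityRecoverySet j.2

theorem HasNoOneSquare.isPIRCode (hA : HasNoOneSquare A) (hr : 1 ≤ r)
    (hcol : ∀ j, #{i | A i j ≠ 0} ≤ r) (hrow : ∀ i, t ≤ #{j | A i j ≠ 0} + 1) :
    IsPIRCode (systematicEncoding A) r t :=
  ⟨(isSystematic_systematicEncoding A).injective, fun i => hA.supportsQuery hr hcol (hrow i)⟩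

end MatrixCode

section Hadamard

/-- The Hadamard code: the coded symbols are the sums of the information symbols over all subsets
of the set of coordinates. -/
def hadamardEncoding (F : Type*) [Field F] (k : ℕ) : (Fin k → F) →ₗ[F] (Finset (Fin k) → F) :=
  LinearMap.pi fun S => ∑ a ∈ S, LinearMap.proj a

variable {F : Type*} [Field F] {k : ℕ}

theorem hadamardEncoding_apply (x : Fin k → F) (S : Finset (Fin k)) :
    hadamardEncoding F k x S = ∑ a ∈ S, x a := by
  simp [hadamardEncoding]

theorem isSystematic_hadamardEncoding : IsSystematic (hadamardEncoding F k) :=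
  ⟨⟨singleton, Finset.singleton_injective⟩, fun x i => by simp [hadamardEncoding_apply]⟩

theorem isRecoverySet_hadamardEncoding {S : Finset (Fin k)} {i : Fin k} (hi : i ∉ S) :
    IsRecoverySet (hadamardEncoding F k) {S, insert i S} i := by
  rw [isRecoverySet_iff_forall_eq_zero]
  intro x hx
  have hS := hx S (by simp)
  have hSi := hx (insert i S) (by simp)
  rwa [hadamardEncoding_apply, Finset.sum_insert hi, ← hadamardEncoding_apply, hS, add_zero] at hSi

theorem existsSystematicPIR_hadamard (F : Type*) [Field F] (k : ℕ) :
    ExistsSystematicPIR F (2 ^ (k + 1)) (k + 1) 2 (2 ^ k) := by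
  refine existsSystematicPIR_of_card_eq (by simp) (hadamardEncoding F (k + 1))
    isSystematic_hadamardEncoding fun i => ?_
  let base : Finset (Fin k) ↪o Finset (Fin (k + 1)) :=
    Finset.mapEmbedding i.succAboveEmb
  have hbase : ∀ S, i ∉ base S := fun S => by simp [base]
  refine supportsQuery_const_of_pairwise_disjoint (R := fun S => {base S, insert i (base S)})
    (by simp) (fun S => Finset.card_le_two) (fun S T hne => ?_)
    fun S => isRecoverySet_hadamardEncoding (hbase S)
  have herase : ∀ S, ∀ U ∈ ({base S, insert i (base S)} : Finset _), U.erase i = base S := by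
    intro S
    simp [hbase]
  exact Finset.disjoint_left.2 fun U hU hU' =>
    hne (base.injective ((herase S U hU).symm.trans (herase T U hU')))

end Hadamard

/-! ### Balanced families of sets -/

theorem exists_lt_of_sum_eq_of_ne {ι M : Type*} [Fintype ι] [AddCommMonoid M] [LinearOrder M]
    [IsOrderedCancelAddMonoid M] {f g : ι → M} (hsum : ∑ i, f i = ∑ i, g i) (hne : f ≠ g) :
    ∃ i, f i < g i := by
  by_contra! hle
  exact hne (funext fun i =>
    ((Finset.sum_eq_sum_iff_of_le fun i _ => hle i).1 hsum.symm i (Finset.mem_univ i)).symm)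

theorem exists_card_eq_and_sum_card_eq {α : Type*} [Fintype α] {N : ℕ}
    (hN : N ≤ Fintype.card α * (Fintype.card α - 1)) :
    ∃ 𝒜 : Finset (Finset α), #𝒜 = (N + 1) / 2 ∧ (∀ A ∈ 𝒜, #A ≤ 2) ∧ ∑ A ∈ 𝒜, #A = N := by
  classical
  have hpairs : N / 2 ≤ #((Finset.univ : Finset α).powersetCard 2) := by
    rw [Finset.card_powersetCard, Finset.card_univ, Nat.choose_two_right]
    exact Nat.div_le_div_right hN
  have hsingles : N % 2 ≤ #((Finset.univ : Finset α).powersetCard 1) := by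
    rw [Finset.card_powersetCard, Finset.card_univ, Nat.choose_one_right]
    have hpos : 0 < N → 0 < Fintype.card α := fun h => Nat.pos_of_mul_pos_right (h.trans_le hN)
    omega
  obtain ⟨𝒢, h𝒢, hcard𝒢⟩ := Finset.exists_subset_card_eq hpairs
  obtain ⟨ℋ, hℋ, hcardℋ⟩ := Finset.exists_subset_card_eq hsingles
  have htwo : ∀ A ∈ 𝒢, #A = 2 := fun A hA => (Finset.mem_powersetCard.1 (h𝒢 hA)).2
  have hone : ∀ A ∈ ℋ, #A = 1 := fun A hA => (Finset.mem_powersetCard.1 (hℋ hA)).2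
  have hdisj : Disjoint 𝒢 ℋ := Finset.disjoint_left.2 fun A h h' => by
    have := htwo A h
    have := hone A h'
    omega
  refine ⟨𝒢 ∪ ℋ, ?_, fun A hA => ?_, ?_⟩
  · rw [Finset.card_union_of_disjoint hdisj]
    omega
  · rcases Finset.mem_union.1 hA with h | h
    · exact (htwo A h).le
    · exact (hone A h).trans_le one_le_two
  · rw [Finset.sum_union hdisj, Finset.sum_const_nat htwo, Finset.sum_const_nat hone]
    omega

section Balanced

variable {α : Type*} [DecidableEq α] {𝒜 : Finset (Finset α)} {A : Finset α} {u v : α}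

/-- The number of members of `𝒜` that contain `a`, that is, the degree of the vertex `a` in the
hypergraph `𝒜`. -/
def familyDegree (𝒜 : Finset (Finset α)) (a : α) : ℕ := #{A ∈ 𝒜 | a ∈ A}

theorem sum_familyDegree [Fintype α] (𝒜 : Finset (Finset α)) :
    ∑ a, familyDegree 𝒜 a = ∑ A ∈ 𝒜, #A := by
  simp only [familyDegree, Finset.card_filter]
  rw [Finset.sum_comm]
  simp

theorem familyDegree_insert (hA : A ∉ 𝒜) (a : α) :
    familyDegree (insert A 𝒜) a = familyDegree 𝒜 a + if a ∈ A then 1 else 0 := by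
  simp only [familyDegree, Finset.card_filter]
  rw [Finset.sum_insert hA, add_comm]

/-- The set `A` with the element `u` replaced by `v`. -/
def exchange (A : Finset α) (u v : α) : Finset α := insert v (A.erase u)

theorem mem_exchange {a : α} : a ∈ exchange A u v ↔ a = v ∨ a ≠ u ∧ a ∈ A := by
  simp [exchange]

theorem card_exchange (hu : u ∈ A) (hv : v ∉ A) : #(exchange A u v) = #A := by
  rw [exchange, Finset.card_insert_of_notMem fun h => hv (Finset.mem_of_mem_erase h),
    Finset.card_erase_add_one hu]

theorem exchange_exchange (hu : u ∈ A) (hv : v ∉ A) : exchange (exchange A u v) v u = A := by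
  rw [exchange, exchange, Finset.erase_insert fun h => hv (Finset.mem_of_mem_erase h),
    Finset.insert_erase hu]

/-- Otherwise exchanging `u` for `v` injects the members through `u` into those through `v`. -/
theorem exists_exchange_notMem (h : familyDegree 𝒜 v < familyDegree 𝒜 u) :
    ∃ A ∈ 𝒜, u ∈ A ∧ v ∉ A ∧ exchange A u v ∉ 𝒜 := by
  by_contra! hall
  have huv : u ≠ v := by
    rintro rfl
    exact h.false
  have hu : ∀ A, u ∉ exchange A u v := fun A => by simp [mem_exchange, huv]
  refine h.not_ge (Finset.card_le_card_of_injOn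
    (fun A => if v ∈ A then A else exchange A u v) (fun A hA => ?_) fun A hA B hB hAB => ?_)
  · obtain ⟨hA, huA⟩ := Finset.mem_filter.1 hA
    by_cases hvA : v ∈ A
    · simpa [hvA] using hA
    · simpa [hvA, mem_exchange] using hall A hA huA hvA
  · replace hA := (Finset.mem_filter.1 hA).2
    replace hB := (Finset.mem_filter.1 hB).2
    dsimp only at hAB
    split_ifs at hAB with hvA hvB hvB
    · exact hAB
    · exact absurd (hAB ▸ hA) (hu B)
    · exact absurd (hAB ▸ hB) (hu A)
    · rw [← exchange_exchange hA hvA, hAB, exchange_exchange hB hvB]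

theorem familyDegree_insert_exchange_erase (hA : A ∈ 𝒜) (huA : u ∈ A) (hvA : v ∉ A)
    (hB : exchange A u v ∉ 𝒜) (a : α) :
    familyDegree (insert (exchange A u v) (𝒜.erase A)) a + (if a = u then 1 else 0) =
      familyDegree 𝒜 a + (if a = v then 1 else 0) := by
  have hdeg := familyDegree_insert (Finset.notMem_erase A 𝒜) a
  rw [Finset.insert_erase hA] at hdeg
  rw [hdeg, familyDegree_insert fun h => hB (Finset.mem_of_mem_erase h), add_assoc, add_assoc]
  congr 1
  have huv : u ≠ v := ne_of_mem_of_not_mem huA hvA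
  by_cases hau : a = u
  · subst hau
    simp [mem_exchange, huA, huv]
  · by_cases hav : a = v
    · subst hav
      simp [mem_exchange, hvA, hau]
    · simp [mem_exchange, hau, hav]

theorem map_card_insert_exchange_erase (hA : A ∈ 𝒜) (huA : u ∈ A) (hvA : v ∉ A)
    (hB : exchange A u v ∉ 𝒜) :
    (insert (exchange A u v) (𝒜.erase A)).val.map Finset.card = 𝒜.val.map Finset.card := by
  rw [Finset.insert_val_of_notMem fun h => hB (Finset.mem_of_mem_erase h), Multiset.map_cons,
    card_exchange huA hvA, ← Multiset.map_cons,
    ← Finset.insert_val_of_notMem (Finset.notMem_erase A 𝒜), Finset.insert_erase hA]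

/-- Exchanges along which degrees become more equal decrease the total deficit
`∑ a, (d - familyDegree 𝒜 a)` until it vanishes. -/
theorem exists_familyDegree_eq [Fintype α] (𝒜 : Finset (Finset α)) (d : ℕ)
    (hsum : ∑ A ∈ 𝒜, #A = d * Fintype.card α) :
    ∃ ℬ : Finset (Finset α), ℬ.val.map Finset.card = 𝒜.val.map Finset.card ∧
      ∀ a, familyDegree ℬ a = d := by
  induction hN : ∑ a, (d - familyDegree 𝒜 a) using Nat.strong_induction_on generalizing 𝒜 with
  | _ N ih =>
  have hmean : ∑ a, familyDegree 𝒜 a = ∑ _a : α, d := by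
    rw [sum_familyDegree, hsum, Finset.sum_const, Finset.card_univ, smul_eq_mul, mul_comm]
  by_cases hall : familyDegree 𝒜 = fun _ => d
  · exact ⟨𝒜, rfl, congrFun hall⟩
  obtain ⟨v, hv⟩ := exists_lt_of_sum_eq_of_ne hmean hall
  obtain ⟨u, hu⟩ := exists_lt_of_sum_eq_of_ne hmean.symm (Ne.symm hall)
  obtain ⟨A, hA, huA, hvA, hB⟩ := exists_exchange_notMem (hv.trans hu)
  have hdeg := familyDegree_insert_exchange_erase hA huA hvA hB
  have hmap := map_card_insert_exchange_erase hA huA hvA hB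
  have huv : u ≠ v := ne_of_mem_of_not_mem huA hvA
  set 𝒜' := insert (exchange A u v) (𝒜.erase A)
  have hdeficit : ∑ a, (d - familyDegree 𝒜' a) < N := by
    rw [← hN]
    refine Finset.sum_lt_sum (fun a _ => ?_) ⟨v, Finset.mem_univ v, ?_⟩
    · specialize hdeg a
      by_cases hau : a = u
      · rw [if_pos hau] at hdeg
        subst hau
        omega
      · rw [if_neg hau] at hdeg
        omega
    · specialize hdeg v
      rw [if_neg huv.symm, if_pos rfl] at hdeg
      omega
  obtain ⟨ℬ, hcard, hreg⟩ := ih _ hdeficit 𝒜'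
    ((congrArg Multiset.sum hmap).trans hsum) rfl
  exact ⟨ℬ, hcard.trans hmap, hreg⟩

theorem exists_regular_family [Fintype α] {d : ℕ} (hd : d + 1 ≤ Fintype.card α) :
    ∃ ℬ : Finset (Finset α), #ℬ = (d * Fintype.card α + 1) / 2 ∧ (∀ A ∈ ℬ, #A ≤ 2) ∧
      ∀ a, familyDegree ℬ a = d := by
  have hpairs : d * Fintype.card α ≤ Fintype.card α * (Fintype.card α - 1) := by
    rw [mul_comm]
    exact Nat.mul_le_mul_left _ (Nat.le_sub_one_of_lt hd)
  obtain ⟨𝒜, hcard, htwo, hsum⟩ := exists_card_eq_and_sum_card_eq hpairs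
  obtain ⟨ℬ, hmap, hreg⟩ := exists_familyDegree_eq 𝒜 d hsum
  refine ⟨ℬ, ?_, fun B hB => ?_, hreg⟩
  · rw [← hcard]
    simpa using congrArg Multiset.card hmap
  · obtain ⟨A, hA, hAB⟩ := Multiset.mem_map.1 (hmap ▸ Multiset.mem_map_of_mem Finset.card hB)
    exact hAB ▸ htwo A hA

end Balanced

section IncidenceMatrix

/-- The incidence matrix of a sequence of sets. -/
def incidenceMatrix (R : Type*) [Zero R] [One R] {α ι : Type*} [DecidableEq α]
    (f : ι → Finset α) : Matrix α ι R :=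
  Matrix.of fun a j => if a ∈ f j then 1 else 0

variable {R : Type*} [Zero R] [One R] [NeZero (1 : R)]

theorem incidenceMatrix_ne_zero_iff {α ι : Type*} [DecidableEq α] {f : ι → Finset α} {a : α}
    {j : ι} : incidenceMatrix R f a j ≠ 0 ↔ a ∈ f j := by
  simp [incidenceMatrix]

theorem hasNoOneSquare_incidenceMatrix {k m : ℕ} {f : Fin m → Finset (Fin k)}
    (hf : Function.Injective f) (htwo : ∀ j, #(f j) ≤ 2) :
    HasNoOneSquare (incidenceMatrix R f) := by
  intro i₁ i₂ j₁ j₂ hi hj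
  by_contra! h
  simp only [incidenceMatrix_ne_zero_iff] at h
  have hpair : ∀ j, i₁ ∈ f j → i₂ ∈ f j → {i₁, i₂} = f j := fun j h₁ h₂ =>
    Finset.eq_of_subset_of_card_le (by simp [Finset.insert_subset_iff, h₁, h₂])
      ((htwo j).trans_eq (Finset.card_pair hi).symm)
  exact hj (hf ((hpair j₁ h.1 h.2.2.1).symm.trans (hpair j₂ h.2.1 h.2.2.2)))

theorem exists_matrix_hasNoOneSquare (R : Type*) [Zero R] [One R] [NeZero (1 : R)]
    [DecidableEq R] {k d : ℕ} (hd : d + 1 ≤ k) :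
    ∃ A : Matrix (Fin k) (Fin ((d * k + 1) / 2)) R, (∀ j, #{i | A i j ≠ 0} ≤ 2) ∧
      (∀ i, #{j | A i j ≠ 0} = d) ∧ HasNoOneSquare A := by
  obtain ⟨ℬ, hcard, htwo, hdeg⟩ := exists_regular_family (α := Fin k) (by simpa using hd)
  rw [Fintype.card_fin] at hcard
  let f : Fin ((d * k + 1) / 2) ↪ Finset (Fin k) :=
    (ℬ.equivFinOfCardEq hcard).symm.toEmbedding.trans (Function.Embedding.subtype _)
  have hf : ∀ j, f j ∈ ℬ := fun j => Subtype.prop _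
  have hℬ : Finset.univ.map f = ℬ := Finset.eq_of_subset_of_card_le
    (fun B hB => by obtain ⟨j, -, rfl⟩ := Finset.mem_map.1 hB; exact hf j) (by simp [hcard])
  refine ⟨incidenceMatrix R f, fun j => ?_, fun i => ?_,
    hasNoOneSquare_incidenceMatrix f.injective fun j => htwo _ (hf j)⟩
  · simpa [incidenceMatrix_ne_zero_iff] using htwo _ (hf j)
  · have hrow := hdeg i
    rw [familyDegree, ← hℬ, Finset.filter_map, Finset.card_map] at hrow
    simpa only [incidenceMatrix_ne_zero_iff, Function.comp_def] using hrow

end IncidenceMatrix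

/-! ### The optimal length -/

section OptimalLength

variable {k r t : ℕ}

theorem existsSystematicPIR_optimalPIRLengthOver (F : Type*) [Field F] (k : ℕ) (hr : 1 ≤ r)
    (ht : 1 ≤ t) : ExistsSystematicPIR F (optimalPIRLengthOver F k r t) k r t :=
  Nat.sInf_mem (s := {n | ExistsSystematicPIR F n k r t})
    ⟨k * t, existsSystematicPIR_repetition F k hr ht⟩

theorem exists_existsSystematicPIR_optimalPIRLength (k : ℕ) (hr : 1 ≤ r) (ht : 1 ≤ t) :
    ∃ (F : Type) (_ : Field F), ExistsSystematicPIR F (optimalPIRLength k r t) k r t := by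
  obtain ⟨F, _, -, hF⟩ := Nat.sInf_mem
    (s := {n | ∃ (F : Type) (_ : Field F) (_ : Finite F), ExistsSystematicPIR F n k r t})
    ⟨k * t, ZMod 2, inferInstance, inferInstance, existsSystematicPIR_repetition _ k hr ht⟩
  exact ⟨F, _, hF⟩

theorem optimalPIRLengthOver_le {F : Type*} [Field F] {n : ℕ} (h : ExistsSystematicPIR F n k r t) :
    optimalPIRLengthOver F k r t ≤ n :=
  Nat.sInf_le h

theorem optimalPIRLength_le {F : Type} [Field F] [Finite F] {n : ℕ}
    (h : ExistsSystematicPIR F n k r t) : optimalPIRLength k r t ≤ n :=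
  Nat.sInf_le ⟨F, inferInstance, inferInstance, h⟩

theorem ceil_natCast_div_two (n : ℕ) : ⌈(n : ℚ) / 2⌉ = ((n + 1) / 2 : ℕ) := by
  have hceil := Rat.ceil_natCast_div_natCast n 2
  rw [Nat.cast_ofNat] at hceil
  rw [hceil]
  omega

theorem ceil_sub_one_mul_div_two (k : ℕ) (ht : 1 ≤ t) :
    ⌈((t : ℚ) - 1) * k / 2⌉ = (((t - 1) * k + 1) / 2 : ℕ) := by
  rw [← ceil_natCast_div_two, Nat.cast_mul, Nat.cast_sub ht, Nat.cast_one]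

theorem le_or_eq_of_le_max_ceil (hk : 3 ≤ k) (htk : (t : ℤ) ≤ max ⌈(k : ℚ) / 2⌉ 2 + 2) :
    t ≤ k ∨ k = 3 ∧ t = 4 := by
  rw [ceil_natCast_div_two] at htk
  omega

theorem exists_matrix_isPIRCode (F : Type*) [Field F] [DecidableEq F] (ht : 1 ≤ t) (htk : t ≤ k) :
    ∃ A : Matrix (Fin k) (Fin (((t - 1) * k + 1) / 2)) F, (∀ j, #{i | A i j ≠ 0} ≤ 2) ∧
      (∀ i, #{j | A i j ≠ 0} = t - 1) ∧ HasNoOneSquare A ∧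
      IsPIRCode (systematicEncoding A) 2 t := by
  obtain ⟨A, hcol, hrow, hA⟩ := exists_matrix_hasNoOneSquare F
    ((Nat.sub_add_cancel ht).trans_le htk)
  exact ⟨A, hcol, hrow, hA, hA.isPIRCode one_le_two hcol fun i => by have := hrow i; omega⟩

theorem existsSystematicPIR_of_le_or_eq (F : Type*) [Field F] (ht : 1 ≤ t)
    (htk : t ≤ k ∨ k = 3 ∧ t = 4) : ExistsSystematicPIR F (k + ((t - 1) * k + 1) / 2) k 2 t := by
  classical
  obtain htk | ⟨rfl, rfl⟩ := htk
  · obtain ⟨A, -, -, -, hA⟩ := exists_matrix_isPIRCode F ht htk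
    exact hA.existsSystematicPIR
  · exact existsSystematicPIR_hadamard F 2

end OptimalLength

theorem mainTheorem3_general (k t : ℕ) (hk : 1 ≤ k) (ht : 1 ≤ t) :
    ((k : ℤ) + t - 2 + ⌈(((t : ℚ) - 1) * ((k : ℚ) - 1) + 1) / t⌉ ≤ (optimalPIRLength k 2 t : ℤ) ∧
      (t ≤ k ∨ k = 3 ∧ t = 4 →
        (optimalPIRLength k 2 t : ℤ) ≤ (k : ℤ) + ⌈((t : ℚ) - 1) * k / 2⌉)) ∧
    ∀ (F : Type*) [Field F],
      ((k : ℤ) + t - 2 + ⌈(((t : ℚ) - 1) * ((k : ℚ) - 1) + 1) / t⌉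
          ≤ (optimalPIRLengthOver F k 2 t : ℤ) ∧
        (t ≤ k ∨ k = 3 ∧ t = 4 →
          (optimalPIRLengthOver F k 2 t : ℤ) ≤ (k : ℤ) + ⌈((t : ℚ) - 1) * k / 2⌉)) ∧
      ∀ [DecidableEq F], t ≤ k → ∃ (m : ℕ) (A : Matrix (Fin k) (Fin m) F),
        (m : ℤ) = ⌈((t : ℚ) - 1) * k / 2⌉ ∧
        (∀ j : Fin m, #{i | A i j ≠ 0} ≤ 2) ∧
        (∀ i : Fin k, #{j | A i j ≠ 0} = t - 1) ∧
        HasNoOneSquare A ∧ IsPIRCode (systematicEncoding A) 2 t := by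
  have hceil := ceil_sub_one_mul_div_two k ht
  refine ⟨⟨?_, fun htk => ?_⟩, fun F _ => ⟨⟨?_, fun htk => ?_⟩, fun htk => ?_⟩⟩
  · obtain ⟨F, _, hF⟩ := exists_existsSystematicPIR_optimalPIRLength k one_le_two ht
    exact hF.ceil_le_length hk ht
  · rw [hceil]
    exact_mod_cast optimalPIRLength_le (existsSystematicPIR_of_le_or_eq (ZMod 2) ht htk)
  · exact (existsSystematicPIR_optimalPIRLengthOver F k one_le_two ht).ceil_le_length hk ht
  · rw [hceil]
    exact_mod_cast optimalPIRLengthOver_le (existsSystematicPIR_of_le_or_eq F ht htk)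
  · exact ⟨_, (exists_matrix_isPIRCode F ht htk).imp fun A hA => ⟨hceil.symm, hA⟩⟩

theorem mainTheorem3 (k t : ℕ) (hk : 1 ≤ k) (ht : 3 ≤ t)
    (htk : (t : ℤ) ≤ max ⌈(k : ℚ) / 2⌉ 2 + 2) :
    -- the bounds for the optimal length over all finite fields
    ((k : ℤ) + t - 2 + ⌈(((t : ℚ) - 1) * ((k : ℚ) - 1) + 1) / t⌉ ≤ (optimalPIRLength k 2 t : ℤ) ∧
      (3 ≤ k → (optimalPIRLength k 2 t : ℤ) ≤ (k : ℤ) + ⌈((t : ℚ) - 1) * k / 2⌉)) ∧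
    -- the same bounds over each fixed finite field
    (∀ (F : Type*) [Field F] [Finite F],
      (k : ℤ) + t - 2 + ⌈(((t : ℚ) - 1) * ((k : ℚ) - 1) + 1) / t⌉
          ≤ (optimalPIRLengthOver F k 2 t : ℤ) ∧
      (3 ≤ k → (optimalPIRLengthOver F k 2 t : ℤ) ≤ (k : ℤ) + ⌈((t : ℚ) - 1) * k / 2⌉)) ∧
    -- a binary code `[I | A]` whose length is the upper bound
    (t ≤ k → ∃ (m : ℕ) (A : Matrix (Fin k) (Fin m) (ZMod 2)),
      (m : ℤ) = ⌈((t : ℚ) - 1) * k / 2⌉ ∧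
      (∀ j : Fin m, (Finset.univ.filter (fun i : Fin k => A i j ≠ 0)).card ≤ 2) ∧
      (∀ i : Fin k, (Finset.univ.filter (fun j : Fin m => A i j ≠ 0)).card = t - 1) ∧
      HasNoOneSquare A ∧
      IsPIRCode (systematicEncoding A) 2 t) := by
  have hupper (hk3 : 3 ≤ k) := le_or_eq_of_le_max_ceil hk3 htk
  have ht1 : 1 ≤ t := by omega
  obtain ⟨hany, hbinary⟩ := mainTheorem3_general.{0} k t hk ht1
  exact ⟨hany.imp_right (· ∘ hupper),
    fun F _ _ => ((mainTheorem3_general k t hk ht1).2 F).1.imp_right (· ∘ hupper),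
    (hbinary (ZMod 2)).2⟩
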